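/- Let $n\ge 1$, $0<c\le \tfrac12$ and $\alpha\ge 0$. A Bayesian network (BN) on binary variables $X_1,\dots,X_n$ is a *tree BN* if its directed acyclic graph gives each node at most one parent; its distribution is $Q(x)=\prod_v Q(x_v\mid x_{\mathrm{pa}(v)})$. Let $\mathcal Q_{c,\alpha}$ be the set of tree BN distributions all of whose conditional probabilities (including the marginals of the roots) lie in $[c,1-c]$ and for which, at each node $v$ and for any two values $a,a'$ of its parent, the conditional means $\mu_{v,a}$ of $X_v$ satisfy $|\mu_{v,a}-\mu_{v,a'}|\le\alpha$. Call such a distribution *$\alpha$-difference-bounded* if moreover the conditional standard deviations satisfy $|\sigma_{v,a}-\sigma_{v,a'}|\le\alpha$, and let $\mathcal D_{c,\alpha}\subseteq\mathcal Q_{c,\alpha}$ be the set of these. For a distribution $P$ on $\{0,1\}^n$, nodes $i\ne j$ and a conditional probability table $Q_{i|j}$, put $$f_P(i,j,Q_{i|j})=\sum_{x\in\{0,1\}}P_j(x)\,d_{KL}\bigl(P_{i|j}(\cdot\mid x)\,\|\,Q_{i|j}(\cdot\mid x)\bigr)-I(P_{i,j}),$$ and let $l_P(i,j)$ be its minimum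 over all $Q_{i|j}$ with $c\le Q_{i|j}(y\mid x)\le 1-c$ and $|Q_{i|j}(y\mid 0)-Q_{i|j}(y\mid 1)|\le\alpha$. For a root $i$, whose parent set is empty, let $l_P(i,\emptyset)=\min_{c\le Q_i\le 1-c}d_{KL}(P_i\|Q_i)$. For a directed spanning tree $T$ of $\{1,\dots,n\}$ put $l_P(T)=\sum_{v}l_P(v,\mathrm{pa}(v))$, the sum being over all nodes including the root. The $l_P$-based difference-restricted directed Chow–Liu algorithm with parameters $c,\alpha$ takes $M$ samples with empirical distribution $\hat P$, and returns a directed spanning tree $\hat T$ that minimizes $l_{\hat P}(T)$ together with the BN distribution $\hat Q$ on $\hat T$ whose conditional probability tables are minimizers of the problems defining $l_{\hat P}(v,\mathrm{pa}(v))$. There is a universal constant $K>0$ such that for all such $n,c,\alpha$, all $\epsilon>0$ and $0<\delta<1$, every distribution $P$ on $\{0,1\}^n$ and every sample size $$M\ \ge\ K\,\frac{n^2}{\epsilon^2}\,\log^2\frac1c\,\log\frac{2n}{\delta}$$ (so a sample size $M=\tilde\Theta\bigl(\tfrac{n^2}{\epsilon^2}\log^2\tfrac1c\bigr)$ suffices),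 the minimizers required by the algorithm exist for every sample and, with probability at least $1-\delta$ over $M$ independent samples from $P$, every possible output (however ties are broken) satisfies $\hat Q\in\mathcal Q_{c,\alpha}$ and $$d_{KL}(P\|\hat Q)\ \le\ \epsilon+\min_{Q\in\mathcal Q_{c,\alpha}}d_{KL}(P\|Q),$$ and, if $\alpha\ge\tfrac12-c$ (in particular for $\alpha=\tfrac12-c$), $\hat Q$ is an $\alpha$-difference-bounded tree BN, that is $\hat Q\in\mathcal D_{c,\alpha}$, and $$d_{KL}(P\|\hat Q)\ \le\ \epsilon+\min_{Q\in\mathcal D_{c,\alpha}}d_{KL}(P\|Q).$$ -/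

import Mathlib

open MeasureTheory

noncomputable section

namespace TreeBN

/-- Assignments to `n` binary variables. -/
abbrev Cube (n : ℕ) : Type := Fin n → Bool

/-- A directed graph on `n` nodes in which each node has at most a single parent
(`none` for a root). -/
abbrev ParentMap (n : ℕ) : Type := Fin n → Option (Fin n)

/-- A conditional probability table of a binary node with at most one parent: the probability of
the value `1`, given the assignment to the parents, which is `none` for a node without parents and
`some b` for a node whose single parent has the value `b`. -/
abbrev Table : Type := Option Bool → ℝ

/-- The graph has no directed cycles. -/
def IsForest {n : ℕ} (pa : ParentMap n) : Prop :=
  ∀ v, ¬ Relation.TransGen (fun u w => pa w = some u) v v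

/-- Directed spanning trees: acyclic, every node has at most one parent, and exactly one node (the
root of the tree) has none. -/
def IsSpanningTree {n : ℕ} (pa : ParentMap n) : Prop :=
  IsForest pa ∧ ∃! r, pa r = none

/-- The Bernoulli distribution with mean `p` on `{0, 1}`. -/
def bern (p : ℝ) (b : Bool) : ℝ := if b then p else 1 - p

/-- The standard deviation of the Bernoulli distribution with mean `p`. -/
def bernStd (p : ℝ) : ℝ := Real.sqrt (p * (1 - p))

/-- The probability `∏ᵥ Q(xᵥ | x_pa(v))` of `x` under the Bayesian network with graph `pa` and
tables `q`. -/
def bnProb {n : ℕ} (pa : ParentMap n) (q : Fin n → Table) (x : Cube n) : ℝ :=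
  ∏ v, bern (q v ((pa v).map x)) (x v)

/-- The distribution of the Bayesian network with graph `pa` and tables `q`. -/
def bnMeasure {n : ℕ} (pa : ParentMap n) (q : Fin n → Table) : Measure (Cube n) :=
  ∑ x, ENNReal.ofReal (bnProb pa q x) • Measure.dirac x

/-- The table `t` of a node with parent `p` is `c`-bounded. -/
def CBounded {n : ℕ} (c : ℝ) (p : Option (Fin n)) (t : Table) : Prop :=
  ∀ (x : Cube n) (b : Bool), c ≤ bern (t (p.map x)) b ∧ bern (t (p.map x)) b ≤ 1 - c

/-- The conditional means in the table `t` of a node with parent `p` differ by at most `α`. -/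
def MeanDiffBounded {n : ℕ} (α : ℝ) (p : Option (Fin n)) (t : Table) : Prop :=
  ∀ x y : Cube n, |t (p.map x) - t (p.map y)| ≤ α

/-- The conditional standard deviations in the table `t` of a node with parent `p` differ by at
most `α`. -/
def StdDiffBounded {n : ℕ} (α : ℝ) (p : Option (Fin n)) (t : Table) : Prop :=
  ∀ x y : Cube n, |bernStd (t (p.map x)) - bernStd (t (p.map y))| ≤ α

/-- Tree Bayesian networks with `c`-bounded tables in which the conditional means of a node differ
by at most `α`. -/
def meanDiffBoundedTreeBNs (n : ℕ) (c α : ℝ) : Set (Measure (Cube n)) :=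
  {Q | IsProbabilityMeasure Q ∧ ∃ (pa : ParentMap n) (q : Fin n → Table), IsForest pa ∧
    (∀ v, CBounded c (pa v) (q v) ∧ MeanDiffBounded α (pa v) (q v)) ∧
    ∀ x, Q.real {x} = bnProb pa q x}

/-- Difference-bounded tree Bayesian networks: `c`-bounded tables in which the conditional means
and the conditional standard deviations of a node differ by at most `α`. -/
def diffBoundedTreeBNs (n : ℕ) (c α : ℝ) : Set (Measure (Cube n)) :=
  {Q | IsProbabilityMeasure Q ∧ ∃ (pa : ParentMap n) (q : Fin n → Table), IsForest pa ∧
    (∀ v, CBounded c (pa v) (q v) ∧ MeanDiffBounded α (pa v) (q v) ∧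
      StdDiffBounded α (pa v) (q v)) ∧
    ∀ x, Q.real {x} = bnProb pa q x}

/-- `R` is a member of the class `𝒞` whose KL divergence from `P` is within `ε` of the smallest one
over the class. -/
def IsApproxIn {n : ℕ} (𝒞 : Set (Measure (Cube n))) (ε : ℝ) (P R : Measure (Cube n)) : Prop :=
  R ∈ 𝒞 ∧ ∀ Q ∈ 𝒞, InformationTheory.klDiv P R ≤ ENNReal.ofReal ε + InformationTheory.klDiv P Q

/-- The marginal `P_p(a)` of the parent. For a root the parent is a dummy variable that always has
the value `none`. -/
def parentProb {n : ℕ} (P : Measure (Cube n)) (p : Option (Fin n)) (a : Option Bool) : ℝ :=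
  P.real {ω | p.map ω = a}

/-- The marginal `P_v(b)`. -/
def nodeProb {n : ℕ} (P : Measure (Cube n)) (v : Fin n) (b : Bool) : ℝ :=
  P.real {ω | ω v = b}

/-- The joint probability of the value `a` of the parent `p` and the value `b` of the node `v`. -/
def jointProb {n : ℕ} (P : Measure (Cube n)) (v : Fin n) (p : Option (Fin n))
    (a : Option Bool) (b : Bool) : ℝ :=
  P.real {ω | p.map ω = a ∧ ω v = b}

/-- The conditional probability `P_{v|p}(b | a)`. -/
def condProb {n : ℕ} (P : Measure (Cube n)) (v : Fin n) (p : Option (Fin n))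
    (a : Option Bool) (b : Bool) : ℝ :=
  jointProb P v p a b / parentProb P p a

/-- The KL divergence of distributions on `{0, 1}`, for positive `s`. -/
def klBool (r s : Bool → ℝ) : ℝ := ∑ b, r b * Real.log (r b / s b)

/-- The mutual information of a node and its parent (it is zero for a root). -/
def mutualInfo {n : ℕ} (P : Measure (Cube n)) (v : Fin n) (p : Option (Fin n)) : ℝ :=
  ∑ a, ∑ b, jointProb P v p a b *
    Real.log (jointProb P v p a b / (parentProb P p a * nodeProb P v b))

/-- The objective `∑ₐ P_p(a) d_KL(P_{v|p}(· | a) ‖ Q_{v|p}(· | a)) - I(P_{p,v})` of the table `t`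
of `Q_{v|p}`. -/
def edgeCost {n : ℕ} (P : Measure (Cube n)) (v : Fin n) (p : Option (Fin n)) (t : Table) : ℝ :=
  (∑ a, parentProb P p a * klBool (condProb P v p a) (bern (t a))) - mutualInfo P v p

/-- The constraints of the optimization problem of an edge. -/
def feasible {n : ℕ} (c α : ℝ) (p : Option (Fin n)) : Set Table :=
  {t | CBounded c p t ∧ MeanDiffBounded α p t}

/-- The weight `l_P(v, p)`: the minimum of the objective over the feasible tables. -/
def edgeLoss {n : ℕ} (c α : ℝ) (P : Measure (Cube n)) (v : Fin n) (p : Option (Fin n)) : ℝ :=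
  sInf (edgeCost P v p '' feasible c α p)

/-- The weight `l_P(T) = ∑ᵥ l_P(v, pa(v))` of a tree. -/
def treeLoss {n : ℕ} (c α : ℝ) (P : Measure (Cube n)) (pa : ParentMap n) : ℝ :=
  ∑ v, edgeLoss c α P v (pa v)

/-- The empirical distribution of a sample. -/
def empirical {n M : ℕ} (s : Fin M → Cube n) : Measure (Cube n) :=
  (M : ENNReal)⁻¹ • ∑ k, Measure.dirac (s k)

/-- `(pa, q)` is a possible output of the `l_P`-based difference-restricted directed Chow–Liu
algorithm with parameters `c, α` on the sample `s`: a directed spanning tree of minimum weight with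
respect to the empirical distribution, with a minimizer of the optimization problem of each of its
edges (and of its root). Ties may be broken in any way. -/
def IsChowLiuOutput {n M : ℕ} (c α : ℝ) (s : Fin M → Cube n)
    (pa : ParentMap n) (q : Fin n → Table) : Prop :=
  IsSpanningTree pa ∧
  (∀ pa' : ParentMap n, IsSpanningTree pa' →
    treeLoss c α (empirical s) pa ≤ treeLoss c α (empirical s) pa') ∧
  ∀ v, q v ∈ feasible c α (pa v) ∧
    IsMinOn (edgeCost (empirical s) v (pa v)) (feasible c α (pa v)) (q v)

end TreeBN

end

namespace TreeBN

/-! ### Forests and spanning trees. -/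

section Forests

variable {n : ℕ}

/-! The algorithm is empirical risk minimization for the log-loss. The objective of an edge equals
the cross entropy of its table minus the entropy of the child, and that entropy depends on neither
parent nor table (`edgeCost_eq`). A minimum-weight tree with optimal tables therefore minimizes the
total empirical cross entropy over all spanning trees and feasible tables, and `klDiv P Q` is the
total cross entropy under `P` minus the entropy of `P`.

Cross entropy is linear in the joint probabilities of node and parent, with coefficients at most
`log (1 / c)` in absolute value. If all these probabilities are estimated to within `η`, every
candidate's risk moves by at most `6 n η log (1 / c)`; using this for the output and for a
competitor bounds the excess risk (`IsChowLiuOutput.isApproxIn`). Hoeffding and a union bound over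
`O(n²)` events supply `η`.

Forests reduce to spanning trees by joining the roots with constant tables. For `α ≥ 1/2 - c` the
condition on standard deviations is automatic, so the two classes coincide. -/

lemma IsForest.exists_forall_not_transGen {pa : ParentMap n} (h : IsForest pa)
    {S : Set (Fin n)} (hS : S.Nonempty) :
    ∃ r ∈ S, ∀ u ∈ S, ¬ Relation.TransGen (fun u w => pa w = some u) u r := by
  have : Std.Irrefl (Relation.TransGen fun u w => pa w = some u) := ⟨h⟩
  have wf := Finite.wellFounded_of_trans_of_irrefl (Relation.TransGen fun u w => pa w = some u)
  exact wf.has_min S hS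

lemma IsForest.exists_forall_pa_ne {pa : ParentMap n} (h : IsForest pa)
    {S : Set (Fin n)} (hS : S.Nonempty) : ∃ r ∈ S, ∀ u ∈ S, pa u ≠ some r := by
  have : Std.Irrefl (Function.swap (Relation.TransGen fun u w => pa w = some u)) := ⟨h⟩
  have : IsTrans _ (Function.swap (Relation.TransGen fun u w => pa w = some u)) :=
    ⟨fun _ _ _ h₁ h₂ => Relation.TransGen.trans h₂ h₁⟩
  have wf := Finite.wellFounded_of_trans_of_irrefl
    (Function.swap (Relation.TransGen fun u w => pa w = some u))
  obtain ⟨r, hr, hmin⟩ := wf.has_min S hS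
  exact ⟨r, hr, fun u hu hur => hmin u hu (Relation.TransGen.single hur)⟩

lemma IsForest.exists_root (hn : 1 ≤ n) {pa : ParentMap n} (h : IsForest pa) :
    ∃ r, pa r = none := by
  obtain ⟨r, -, hr⟩ := h.exists_forall_not_transGen (S := Set.univ) ⟨⟨0, hn⟩, trivial⟩
  refine ⟨r, ?_⟩
  cases hp : pa r with
  | none => rfl
  | some u => exact (hr u trivial (Relation.TransGen.single hp)).elim

/-- Make `r` the parent of all other roots. -/
def attachRoots (pa : ParentMap n) (r : Fin n) : ParentMap n := fun v =>
  if pa v = none ∧ v ≠ r then some r else pa v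

/-- Every new edge leaves `r`, and `r` still has no parent, so no cycle can use a new edge. -/
lemma isSpanningTree_attachRoots {pa : ParentMap n} (h : IsForest pa) {r : Fin n}
    (hr : pa r = none) : IsSpanningTree (attachRoots pa r) := by
  have hr' : attachRoots pa r r = none := by simp [attachRoots, hr]
  have key : ∀ u w, Relation.TransGen (fun u w => attachRoots pa r w = some u) u w → u ≠ r →
      Relation.TransGen (fun u w => pa w = some u) u w := by
    intro u w huw hu
    induction huw with
    | single e =>
      refine Relation.TransGen.single ?_
      unfold attachRoots at e
      split_ifs at e with hc
      · exact absurd (Option.some.inj e).symm hu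
      · exact e
    | @tail b d hb e ih =>
      refine ih.tail ?_
      have hbr : b ≠ r := by
        rintro rfl
        obtain ⟨z, -, hz⟩ := Relation.TransGen.tail'_iff.1 hb
        rw [hr'] at hz
        cases hz
      unfold attachRoots at e
      split_ifs at e with hc
      · exact absurd (Option.some.inj e).symm hbr
      · exact e
  refine ⟨fun v hv => ?_, r, hr', fun v hv => ?_⟩
  · by_cases hvr : v = r
    · subst hvr
      obtain ⟨z, -, hz⟩ := Relation.TransGen.tail'_iff.1 hv
      rw [hr'] at hz
      cases hz
    · exact h v (key v v hv hvr)
  · by_contra hvr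
    have hv : attachRoots pa r v = none := hv
    unfold attachRoots at hv
    split_ifs at hv with hc
    exact hc ⟨hv, hvr⟩

/-- The tables which describe the same distribution after `attachRoots`. -/
def attachTables (pa : ParentMap n) (r : Fin n) (q : Fin n → Table) : Fin n → Table := fun v =>
  if pa v = none ∧ v ≠ r then fun _ => q v none else q v

lemma attachTables_apply (pa : ParentMap n) (r : Fin n) (q : Fin n → Table) (v : Fin n)
    (x : Cube n) :
    attachTables pa r q v ((attachRoots pa r v).map x) = q v ((pa v).map x) := by
  unfold attachTables attachRoots
  split_ifs with hc
  · simp [hc.1]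
  · rfl

lemma isForest_empty : IsForest (fun _ => none : ParentMap n) := fun v hv => by
  obtain ⟨z, -, hz⟩ := Relation.TransGen.tail'_iff.1 hv
  cases hz

lemma exists_isSpanningTree (hn : 1 ≤ n) : ∃ pa : ParentMap n, IsSpanningTree pa :=
  ⟨_, isSpanningTree_attachRoots isForest_empty (r := ⟨0, hn⟩) rfl⟩

end Forests

/-! ### Normalization of network distributions; standard deviations. -/

section Normalization

variable {n : ℕ}

lemma bern_add_bern_not (p : ℝ) (b : Bool) : bern p b + bern p (!b) = 1 := by
  cases b <;> simp [bern]

/-- Induction removes a node `v` that is no parent within `S`. Flipping coordinate `v` changes only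
the factor of `v`, and the two values of that factor add up to 1. Summing over the whole cube counts
each remaining term twice, whence the powers of 2. -/
lemma two_pow_mul_sum_prod_bern {pa : ParentMap n} (h : IsForest pa) (q : Fin n → Table)
    (S : Finset (Fin n)) :
    2 ^ S.card * ∑ x : Cube n, ∏ v ∈ S, bern (q v ((pa v).map x)) (x v) = 2 ^ n := by
  induction S using Finset.strongInduction with
  | H S ih =>
  rcases S.eq_empty_or_nonempty with rfl | hS
  · simp
  obtain ⟨v, hv, hmax⟩ := h.exists_forall_pa_ne (S := (S : Set (Fin n))) hS
  have hv : v ∈ S := hv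
  have hvv : pa v ≠ some v := fun e => h v (Relation.TransGen.single e)
  let σ : Cube n ≃ Cube n := Function.Involutive.toPerm
    (fun x => Function.update x v (!x v)) (fun x => by simp)
  have hσ : ∀ x, σ x = Function.update x v (!x v) := fun _ => rfl
  have hpar : ∀ w ∈ S, ∀ x, (pa w).map (σ x) = (pa w).map x := by
    intro w hw x
    cases hp : pa w with
    | none => rfl
    | some u =>
      have : u ≠ v := fun e => hmax w hw (e ▸ hp)
      simp [hσ, this]
  have hflip : ∀ x, ∏ w ∈ S, bern (q w ((pa w).map (σ x))) (σ x w) =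
      bern (q v ((pa v).map x)) (!x v) *
        ∏ w ∈ S.erase v, bern (q w ((pa w).map x)) (x w) := by
    intro x
    rw [← Finset.mul_prod_erase S _ hv, hpar v hv]
    congr 1
    · simp [hσ]
    · refine Finset.prod_congr rfl fun w hw => ?_
      rw [hpar w (Finset.mem_of_mem_erase hw), hσ,
        Function.update_of_ne (Finset.ne_of_mem_erase hw)]
  have hsum : 2 * ∑ x : Cube n, ∏ w ∈ S, bern (q w ((pa w).map x)) (x w) =
      ∑ x : Cube n, ∏ w ∈ S.erase v, bern (q w ((pa w).map x)) (x w) := by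
    rw [two_mul]
    nth_rewrite 2 [← Equiv.sum_comp σ]
    rw [← Finset.sum_add_distrib]
    refine Finset.sum_congr rfl fun x _ => ?_
    rw [hflip, ← Finset.mul_prod_erase S _ hv, ← add_mul, bern_add_bern_not, one_mul]
  have hcard : S.card = (S.erase v).card + 1 := by
    rw [Finset.card_erase_of_mem hv]
    have := Finset.card_pos.2 hS
    omega
  rw [hcard, pow_succ, mul_assoc, hsum]
  exact ih _ (Finset.erase_ssubset hv)

lemma sum_bnProb {pa : ParentMap n} (h : IsForest pa) (q : Fin n → Table) :
    ∑ x, bnProb pa q x = 1 := by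
  have := two_pow_mul_sum_prod_bern h q Finset.univ
  rw [Finset.card_univ, Fintype.card_fin] at this
  exact mul_left_cancel₀ (by positivity : (2 : ℝ) ^ n ≠ 0) (by rw [mul_one]; exact this)

lemma CBounded.bern_pos {c : ℝ} (hc : 0 < c) {p : Option (Fin n)} {t : Table}
    (h : CBounded c p t) (x : Cube n) (b : Bool) : 0 < bern (t (p.map x)) b :=
  hc.trans_le (h x b).1

lemma bnProb_pos {c : ℝ} (hc : 0 < c) {pa : ParentMap n} {q : Fin n → Table}
    (h : ∀ v, CBounded c (pa v) (q v)) (x : Cube n) : 0 < bnProb pa q x :=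
  Finset.prod_pos fun v _ => (h v).bern_pos hc x (x v)

lemma bnMeasure_singleton (pa : ParentMap n) (q : Fin n → Table) (x : Cube n) :
    bnMeasure pa q {x} = ENNReal.ofReal (bnProb pa q x) := by
  simp [bnMeasure, Measure.finsetSum_apply, Set.indicator_apply]

lemma isProbabilityMeasure_bnMeasure {c : ℝ} (hc : 0 < c) {pa : ParentMap n}
    {q : Fin n → Table} (hpa : IsForest pa) (h : ∀ v, CBounded c (pa v) (q v)) :
    IsProbabilityMeasure (bnMeasure pa q) := by
  constructor
  have : bnMeasure pa q Set.univ = ∑ x, ENNReal.ofReal (bnProb pa q x) := by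
    simp [bnMeasure, Measure.finsetSum_apply]
  rw [this, ← ENNReal.ofReal_sum_of_nonneg fun x _ => (bnProb_pos hc h x).le, sum_bnProb hpa,
    ENNReal.ofReal_one]

lemma bnMeasure_mem {c α : ℝ} (hc : 0 < c) {pa : ParentMap n} {q : Fin n → Table}
    (hpa : IsForest pa) (h : ∀ v, q v ∈ feasible c α (pa v)) :
    bnMeasure pa q ∈ meanDiffBoundedTreeBNs n c α := by
  refine ⟨isProbabilityMeasure_bnMeasure hc hpa fun v => (h v).1, pa, q, hpa, h, fun x => ?_⟩
  rw [measureReal_def, bnMeasure_singleton,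
    ENNReal.toReal_ofReal (bnProb_pos hc (fun v => (h v).1) x).le]

lemma bernStd_mem {c p : ℝ} (hc : 0 < c) (hc' : c ≤ 1 / 2) (h₁ : c ≤ p) (h₂ : p ≤ 1 - c) :
    c ≤ bernStd p ∧ bernStd p ≤ 1 / 2 := by
  constructor
  · exact Real.le_sqrt_of_sq_le (by nlinarith)
  · exact Real.sqrt_le_iff.2 ⟨by norm_num, by nlinarith [sq_nonneg (p - 1 / 2)]⟩

/-- All standard deviations lie in `[c, 1/2]`, an interval of length `1/2 - c`. -/
lemma CBounded.stdDiffBounded {c α : ℝ} (hc : 0 < c) (hc' : c ≤ 1 / 2) (hα : 1 / 2 - c ≤ α)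
    {p : Option (Fin n)} {t : Table} (h : CBounded c p t) : StdDiffBounded α p t := by
  intro x y
  have hx := h x true
  have hy := h y true
  simp only [bern, if_true] at hx hy
  have hx := bernStd_mem hc hc' hx.1 hx.2
  have hy := bernStd_mem hc hc' hy.1 hy.2
  rw [abs_le]
  constructor <;> linarith

lemma diffBoundedTreeBNs_eq {c α : ℝ} (hc : 0 < c) (hc' : c ≤ 1 / 2) (hα : 1 / 2 - c ≤ α) :
    diffBoundedTreeBNs n c α = meanDiffBoundedTreeBNs n c α := by
  ext Q
  constructor
  · rintro ⟨hQ, pa, q, hpa, h, hx⟩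
    exact ⟨hQ, pa, q, hpa, fun v => ⟨(h v).1, (h v).2.1⟩, hx⟩
  · rintro ⟨hQ, pa, q, hpa, h, hx⟩
    exact ⟨hQ, pa, q, hpa,
      fun v => ⟨(h v).1, (h v).2, (h v).1.stdDiffBounded hc hc' hα⟩, hx⟩

end Normalization

end TreeBN

noncomputable section

namespace TreeBN

/-! ### Edge costs and KL divergence as cross entropies. -/

section CrossEntropy

variable {n : ℕ}

/-- The expected negative log-likelihood of the table `t` for the node `v` with parent `p`. -/
def crossEntropy (P : Measure (Cube n)) (v : Fin n) (p : Option (Fin n)) (t : Table) : ℝ :=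
  ∑ x : Cube n, P.real {x} * -Real.log (bern (t (p.map x)) (x v))

lemma measureReal_eq_sum (P : Measure (Cube n)) [IsFiniteMeasure P] (p : Cube n → Prop)
    [DecidablePred p] : P.real {x | p x} = ∑ x, if p x then P.real {x} else 0 := by
  rw [← Finset.sum_filter, sum_measureReal_singleton]
  simp

lemma sum_jointProb_mul (P : Measure (Cube n)) [IsFiniteMeasure P] (v : Fin n)
    (p : Option (Fin n)) (g : Option Bool → Bool → ℝ) :
    ∑ a, ∑ b, jointProb P v p a b * g a b = ∑ x, P.real {x} * g (p.map x) (x v) := by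
  have h : ∀ a b, jointProb P v p a b * g a b =
      ∑ x : Cube n, if p.map x = a then (if x v = b then P.real {x} * g a b else 0) else 0 := by
    intro a b
    rw [jointProb, measureReal_eq_sum, Finset.sum_mul]
    refine Finset.sum_congr rfl fun x _ => ?_
    by_cases h₁ : p.map x = a <;> by_cases h₂ : x v = b <;> simp [h₁, h₂]
  simp_rw [h]
  calc _ = ∑ a, ∑ x : Cube n, if p.map x = a then P.real {x} * g a (x v) else 0 := by
        refine Finset.sum_congr rfl fun a _ => ?_
        rw [Finset.sum_comm]
        refine Finset.sum_congr rfl fun x _ => ?_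
        split_ifs <;> simp
    _ = _ := by
        rw [Finset.sum_comm]
        simp

lemma crossEntropy_eq_sum_jointProb (P : Measure (Cube n)) [IsFiniteMeasure P] (v : Fin n)
    (p : Option (Fin n)) (t : Table) :
    crossEntropy P v p t = ∑ a, ∑ b, jointProb P v p a b * -Real.log (bern (t a) b) :=
  (sum_jointProb_mul P v p fun a b => -Real.log (bern (t a) b)).symm

lemma sum_jointProb (P : Measure (Cube n)) [IsFiniteMeasure P] (v : Fin n)
    (p : Option (Fin n)) (g : Bool → ℝ) :
    ∑ a, ∑ b, jointProb P v p a b * g b = ∑ b, nodeProb P v b * g b := by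
  rw [sum_jointProb_mul P v p fun _ b => g b]
  simp_rw [nodeProb, measureReal_eq_sum, Finset.sum_mul]
  rw [Finset.sum_comm]
  simp

lemma jointProb_eq_zero_of_forall_ne {P : Measure (Cube n)} {v : Fin n} {p : Option (Fin n)}
    {a : Option Bool} (ha : ∀ x : Cube n, p.map x ≠ a) (b : Bool) :
    jointProb P v p a b = 0 := by
  simp [jointProb, ha]

/-- The objective of an edge is the cross entropy up to the entropy of the node, which does not
depend on the parent. -/
lemma edgeCost_eq {P : Measure (Cube n)} [IsFiniteMeasure P] {v : Fin n}
    {p : Option (Fin n)} {t : Table} (ht : ∀ (x : Cube n) b, 0 < bern (t (p.map x)) b) :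
    edgeCost P v p t =
      crossEntropy P v p t + ∑ b, nodeProb P v b * Real.log (nodeProb P v b) := by
  rw [crossEntropy_eq_sum_jointProb, ← sum_jointProb P v p fun b => Real.log (nodeProb P v b),
    edgeCost, mutualInfo, ← Finset.sum_sub_distrib, ← Finset.sum_add_distrib]
  refine Finset.sum_congr rfl fun a _ => ?_
  rw [klBool, Finset.mul_sum, ← Finset.sum_sub_distrib, ← Finset.sum_add_distrib]
  refine Finset.sum_congr rfl fun b _ => ?_
  rw [condProb]
  by_cases hj : jointProb P v p a b = 0
  · simp [hj]
  have hj' : 0 < jointProb P v p a b := lt_of_le_of_ne measureReal_nonneg (Ne.symm hj)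
  have hp : 0 < parentProb P p a := hj'.trans_le (measureReal_mono fun x hx => hx.1)
  have hv : 0 < nodeProb P v b := hj'.trans_le (measureReal_mono fun x hx => hx.2)
  -- Tables are unconstrained at parent values that never occur, but there the joint probability
  -- vanishes.
  have hb : 0 < bern (t a) b := by
    by_contra hb
    refine hj (jointProb_eq_zero_of_forall_ne (fun x hx => hb ?_) b)
    rw [← hx]
    exact ht x b
  rw [Real.log_div (div_pos hj' hp).ne' hb.ne', Real.log_div hj'.ne' hp.ne',
    Real.log_div hj'.ne' (mul_pos hp hv).ne', Real.log_mul hp.ne' hv.ne']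
  field_simp
  ring

lemma sum_crossEntropy {P : Measure (Cube n)} {pa : ParentMap n} {q : Fin n → Table}
    (h : ∀ v (x : Cube n) b, 0 < bern (q v ((pa v).map x)) b) :
    ∑ v, crossEntropy P v (pa v) (q v) = ∑ x, P.real {x} * -Real.log (bnProb pa q x) := by
  unfold crossEntropy
  rw [Finset.sum_comm]
  refine Finset.sum_congr rfl fun x _ => ?_
  rw [← Finset.mul_sum, bnProb, Real.log_prod fun v _ => (h v x _).ne', Finset.sum_neg_distrib]

lemma klDiv_eq_of_pos (P Q : Measure (Cube n)) [IsProbabilityMeasure P] [IsProbabilityMeasure Q]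
    (hQ : ∀ x, 0 < Q.real {x}) :
    InformationTheory.klDiv P Q = ENNReal.ofReal
      (∑ x, P.real {x} * Real.log (P.real {x}) + ∑ x, P.real {x} * -Real.log (Q.real {x})) := by
  have hac : P ≪ Q := by
    refine Measure.AbsolutelyContinuous.mk fun s _ hs => ?_
    have : s = ∅ := by
      by_contra hne
      obtain ⟨x, hx⟩ := Set.nonempty_iff_ne_empty.2 hne
      have h0 : Q {x} = 0 := measure_mono_null (Set.singleton_subset_iff.2 hx) hs
      have := hQ x
      simp [measureReal_def, h0] at this
    simp [this]
  have hrn : ∀ x, (P.rnDeriv Q x).toReal = P.real {x} / Q.real {x} := by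
    intro x
    have h := Measure.setLIntegral_rnDeriv hac {x}
    rw [lintegral_singleton] at h
    rw [eq_div_iff (hQ x).ne', measureReal_def, measureReal_def, ← ENNReal.toReal_mul, h]
  rw [InformationTheory.klDiv_of_ac_of_integrable hac Integrable.of_finite, integral_fintype
    Integrable.of_finite]
  -- The total-mass correction in `klDiv` cancels for probability measures.
  simp only [probReal_univ, add_sub_cancel_right]
  rw [← Finset.sum_add_distrib]
  congr 1
  refine Finset.sum_congr rfl fun x _ => ?_
  rw [llr, hrn, smul_eq_mul]
  by_cases h0 : P.real {x} = 0
  · simp [h0]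
  · rw [Real.log_div h0 (hQ x).ne']
    ring

end CrossEntropy

/-! ### Existence of optimal tables. -/

section Minimizers

variable {n : ℕ}

lemma bern_half (b : Bool) : bern (1 / 2) b = 1 / 2 := by
  cases b <;> norm_num [bern]

lemma continuous_bern (b : Bool) : Continuous fun p => bern p b := by
  cases b
  · exact continuous_const.sub continuous_id
  · exact continuous_id

/-- Replace the entries of a table which are never used by `1 / 2`. -/
def normalizeTable (p : Option (Fin n)) (t : Table) : Table :=
  open Classical in fun a => if ∃ x : Cube n, p.map x = a then t a else 1 / 2

lemma normalizeTable_map (p : Option (Fin n)) (t : Table) (x : Cube n) :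
    normalizeTable p t (p.map x) = t (p.map x) :=
  if_pos ⟨x, rfl⟩

/-- The feasible set is not compact, since unused entries are arbitrary reals. The cross entropy is
minimized on its compact intersection with the box `D`; any feasible table moves into `D` at equal
cost by resetting its unused entries. -/
lemma exists_isMinOn_edgeCost {c α : ℝ} (hc : 0 < c) (hc' : c ≤ 1 / 2) (hα : 0 ≤ α)
    (P : Measure (Cube n)) [IsFiniteMeasure P] (v : Fin n) (p : Option (Fin n)) :
    ∃ t ∈ feasible c α p, IsMinOn (edgeCost P v p) (feasible c α p) t := by
  let D : Set Table := {t | ∀ a, t a ∈ Set.Icc c (1 - c)}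
  have hDpos : ∀ t ∈ D, ∀ a b, 0 < bern (t a) b := by
    intro t ht a b
    have := ht a
    cases b <;> simp only [bern] <;> simp <;> linarith [this.1, this.2]
  have hDc : IsCompact D := by
    have : D = Set.univ.pi fun _ => Set.Icc c (1 - c) := by
      ext t
      simp only [D, Set.mem_pi, Set.mem_ofPred_eq, Set.mem_univ, true_implies]
    rw [this]
    exact isCompact_univ_pi fun _ => isCompact_Icc
  have hclosed : IsClosed (feasible c α p : Set Table) := by
    have : (feasible c α p : Set Table) =
        (⋂ x : Cube n, ⋂ b, ({t | c ≤ bern (t (p.map x)) b} ∩ {t | bern (t (p.map x)) b ≤ 1 - c}))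
          ∩ ⋂ x : Cube n, ⋂ y : Cube n, {t | |t (p.map x) - t (p.map y)| ≤ α} := by
      ext t
      simp [feasible, CBounded, MeanDiffBounded]
    rw [this]
    have hb : ∀ (x : Cube n) b, Continuous fun t : Table => bern (t (p.map x)) b := fun x b =>
      (continuous_bern b).comp (continuous_apply _)
    refine (isClosed_iInter fun x => isClosed_iInter fun b =>
      (isClosed_le continuous_const (hb x b)).inter (isClosed_le (hb x b) continuous_const)).inter
      (isClosed_iInter fun x => isClosed_iInter fun y => isClosed_le ?_ continuous_const)
    fun_prop
  have hhalf : (fun _ => 1 / 2 : Table) ∈ feasible c α p ∩ D := by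
    refine ⟨⟨fun x b => ?_, fun x y => by simpa using hα⟩, fun a => ⟨?_, ?_⟩⟩
    · rw [bern_half]
      constructor <;> linarith
    · exact hc'
    · linarith
  have hcont : ContinuousOn (crossEntropy P v p) (feasible c α p ∩ D) := by
    unfold crossEntropy
    refine continuousOn_finsetSum _ fun x _ => continuousOn_const.mul (ContinuousOn.neg ?_)
    refine ContinuousOn.log ?_ fun t ht => (hDpos t ht.2 _ _).ne'
    exact ((continuous_bern _).comp (continuous_apply _)).continuousOn
  obtain ⟨t, ht, hmin⟩ := (hDc.inter_left hclosed).exists_isMinOn ⟨_, hhalf⟩ hcont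
  refine ⟨t, ht.1, fun u hu => ?_⟩
  have hpos : ∀ u ∈ feasible c α p, ∀ (x : Cube n) b, 0 < bern (u (p.map x)) b :=
    fun u hu x b => hc.trans_le (hu.1 x b).1
  have hnorm : normalizeTable p u ∈ feasible c α p ∩ D := by
    refine ⟨⟨fun x b => ?_, fun x y => ?_⟩, fun a => ?_⟩
    · rw [normalizeTable_map]
      exact hu.1 x b
    · rw [normalizeTable_map, normalizeTable_map]
      exact hu.2 x y
    · by_cases ha : ∃ x : Cube n, p.map x = a
      · obtain ⟨x, rfl⟩ := ha
        rw [normalizeTable_map]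
        exact hu.1 x true
      · rw [normalizeTable, if_neg ha]
        exact ⟨hc', by linarith⟩
  have h := hmin hnorm
  have he : crossEntropy P v p (normalizeTable p u) = crossEntropy P v p u := by
    simp only [crossEntropy, normalizeTable_map]
  simp only [Set.mem_ofPred_eq] at h ⊢
  rw [edgeCost_eq (hpos t ht.1), edgeCost_eq (hpos u hu)]
  linarith

lemma edgeLoss_eq_of_isMinOn {c α : ℝ} {P : Measure (Cube n)} {v : Fin n} {p : Option (Fin n)}
    {t : Table} (ht : t ∈ feasible c α p)
    (hmin : IsMinOn (edgeCost P v p) (feasible c α p) t) :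
    edgeLoss c α P v p = edgeCost P v p t :=
  IsLeast.csInf_eq ⟨⟨t, ht, rfl⟩, by rintro _ ⟨u, hu, rfl⟩; exact hmin hu⟩

lemma edgeLoss_le {c α : ℝ} (hc : 0 < c) (hc' : c ≤ 1 / 2) (hα : 0 ≤ α)
    (P : Measure (Cube n)) [IsFiniteMeasure P] (v : Fin n) {p : Option (Fin n)} {t : Table}
    (ht : t ∈ feasible c α p) : edgeLoss c α P v p ≤ edgeCost P v p t := by
  obtain ⟨u, hu, hmin⟩ := exists_isMinOn_edgeCost hc hc' hα P v p
  rw [edgeLoss_eq_of_isMinOn hu hmin]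
  exact hmin ht

end Minimizers

end TreeBN

end

namespace TreeBN

/-! ### Hoeffding bounds for the empirical distribution. -/

section Concentration

/-- One-sided Hoeffding inequality for the mean of independent copies of `f`. -/
lemma pi_real_sum_sub_ge_le {Ω : Type*} [MeasurableSpace Ω] (P : Measure Ω)
    [IsProbabilityMeasure P] {M : ℕ} (hM : 0 < M) {f : Ω → ℝ} (hf : Measurable f) {a : ℝ}
    (hb : ∀ ω, f ω ∈ Set.Icc a (a + 1)) {η : ℝ} (hη : 0 ≤ η) :
    (Measure.pi fun _ : Fin M => P).real {s | M * η ≤ ∑ k, (f (s k) - ∫ ω, f ω ∂P)} ≤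
      Real.exp (-(2 * M * η ^ 2)) := by
  set μ := Measure.pi fun _ : Fin M => P
  have hind : ProbabilityTheory.iIndepFun
      (fun (k : Fin M) (s : Fin M → Ω) => f (s k) - ∫ ω, f ω ∂P) μ :=
    ProbabilityTheory.iIndepFun_pi (X := fun (_ : Fin M) ω => f ω - ∫ ω, f ω ∂P)
      fun _ => (hf.sub_const _).aemeasurable
  -- Hoeffding's lemma: range 1 gives variance proxy 1/4.
  have hsub : ∀ k ∈ Finset.univ, ProbabilityTheory.HasSubgaussianMGF
      (fun s : Fin M → Ω => f (s k) - ∫ ω, f ω ∂P) ((‖a + 1 - a‖₊ / 2) ^ 2) μ := by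
    intro k _
    have h := ProbabilityTheory.hasSubgaussianMGF_of_mem_Icc (μ := μ)
      (X := fun s => f (s k)) (hf.comp (measurable_pi_apply k)).aemeasurable
      (Filter.Eventually.of_forall fun s => hb (s k))
    have he : ∫ s, f (s k) ∂μ = ∫ ω, f ω ∂P := by
      have hk := (measurePreserving_eval (fun _ : Fin M => P) k).map_eq
      rw [← hk]
      exact (integral_map (measurable_pi_apply k).aemeasurable hf.aestronglyMeasurable).symm
    rwa [he] at h
  refine (ProbabilityTheory.HasSubgaussianMGF.measure_sum_ge_le_of_iIndepFun hind hsub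
    (by positivity)).trans (le_of_eq ?_)
  have hM' : (M : ℝ) ≠ 0 := by positivity
  congr 1
  simp
  field_simp

variable {n M : ℕ}

lemma empirical_real (s : Fin M → Cube n) (S : Set (Cube n)) :
    (empirical s).real S = (M : ℝ)⁻¹ * ∑ k, S.indicator 1 (s k) := by
  have h : ∀ k, (Measure.dirac (s k)).real S = S.indicator 1 (s k) := by
    intro k
    by_cases hk : s k ∈ S <;> simp [measureReal_def, hk]
  have hsum : (∑ k, Measure.dirac (s k)).real S = ∑ k, (Measure.dirac (s k)).real S := by
    simp only [measureReal_def, Measure.finsetSum_apply]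
    exact ENNReal.toReal_sum fun k _ => measure_ne_top _ _
  rw [empirical, measureReal_ennreal_smul_apply, hsum, ENNReal.toReal_inv, ENNReal.toReal_natCast]
  simp_rw [h]

lemma isFiniteMeasure_empirical (hM : 0 < M) (s : Fin M → Cube n) :
    IsFiniteMeasure (empirical s) := by
  have : (M : ENNReal)⁻¹ ≠ ⊤ := by simpa using hM.ne'
  exact Measure.smul_finite _ this

lemma pi_real_empirical_deviation_le (P : Measure (Cube n)) [IsProbabilityMeasure P]
    (hM : 0 < M) (S : Set (Cube n)) {η : ℝ} (hη : 0 ≤ η) :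
    (Measure.pi fun _ : Fin M => P).real {s | η < |(empirical s).real S - P.real S|} ≤
      2 * Real.exp (-(2 * M * η ^ 2)) := by
  have hS : MeasurableSet S := S.toFinite.measurableSet
  have hM' : (0 : ℝ) < M := by exact_mod_cast hM
  have hint : ∫ ω, S.indicator (1 : Cube n → ℝ) ω ∂P = P.real S := integral_indicator_one hS
  have hmem : ∀ ω, S.indicator (1 : Cube n → ℝ) ω ∈ Set.Icc (0 : ℝ) (0 + 1) := by
    intro ω
    by_cases h : ω ∈ S <;> simp [h]
  have hup := pi_real_sum_sub_ge_le P hM (f := S.indicator 1)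
    (measurable_one.indicator hS) hmem hη
  have hlow := pi_real_sum_sub_ge_le P hM (f := fun ω => -S.indicator 1 ω) (a := -1)
    (measurable_one.indicator hS).neg
    (fun ω => ⟨by linarith [(hmem ω).2], by linarith [(hmem ω).1]⟩) hη
  rw [integral_neg, hint] at hlow
  rw [hint] at hup
  have hmean : ∀ s : Fin M → Cube n,
      M * (empirical s).real S = ∑ k, S.indicator (1 : Cube n → ℝ) (s k) := by
    intro s
    rw [empirical_real, mul_inv_cancel_left₀ hM'.ne']
  rw [two_mul]
  refine le_trans (measureReal_mono (fun s hs => ?_) (measure_ne_top _ _))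
    ((measureReal_union_le _ _).trans (add_le_add hup hlow))
  rcases lt_abs.1 (show η < |(empirical s).real S - P.real S| from hs) with h | h
  · left
    have := mul_le_mul_of_nonneg_left h.le hM'.le
    simp only [Set.mem_ofPred_eq, Finset.sum_sub_distrib, Finset.sum_const, Finset.card_univ,
      Fintype.card_fin, nsmul_eq_mul, ← hmean]
    linarith
  · right
    have := mul_le_mul_of_nonneg_left h.le hM'.le
    simp only [Set.mem_ofPred_eq, Finset.sum_sub_distrib, Finset.sum_const, Finset.card_univ,
      Fintype.card_fin, nsmul_eq_mul, Finset.sum_neg_distrib, ← hmean]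
    linarith

/-- With high probability all joint distributions of a node and its parent are estimated well. -/
lemma pi_real_jointProb_deviation_ge (P : Measure (Cube n)) [IsProbabilityMeasure P]
    (hM : 0 < M) {η : ℝ} (hη : 0 ≤ η) :
    1 - 12 * (n * (n + 1)) * Real.exp (-(2 * M * η ^ 2)) ≤
      (Measure.pi fun _ : Fin M => P).real
        {s | ∀ v p a b, |jointProb (empirical s) v p a b - jointProb P v p a b| ≤ η} := by
  set G : Set (Fin M → Cube n) :=
    {s | ∀ v p a b, |jointProb (empirical s) v p a b - jointProb P v p a b| ≤ η}
  -- There are `n * (n + 1) * 3 * 2` events, each with a two-sided bound; hence the factor 12.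
  let ι := Fin n × Option (Fin n) × Option Bool × Bool
  let B : ι → Set (Fin M → Cube n) := fun i =>
    {s | η < |jointProb (empirical s) i.1 i.2.1 i.2.2.1 i.2.2.2 -
      jointProb P i.1 i.2.1 i.2.2.1 i.2.2.2|}
  have hG : Gᶜ ⊆ ⋃ i, B i := by
    intro s hs
    simp only [G, Set.mem_compl_iff, Set.mem_ofPred_eq, not_forall, not_le] at hs
    obtain ⟨v, p, a, b, h⟩ := hs
    exact Set.mem_iUnion.2 ⟨(v, p, a, b), h⟩
  have hbound : (Measure.pi fun _ : Fin M => P).real Gᶜ ≤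
      12 * (n * (n + 1)) * Real.exp (-(2 * M * η ^ 2)) := by
    refine (measureReal_mono hG).trans ((measureReal_iUnion_fintype_le B).trans
      ((Finset.sum_le_sum fun i _ => pi_real_empirical_deviation_le P hM _ hη).trans
        (le_of_eq ?_)))
    simp [ι, Finset.sum_const, Fintype.card_prod]
    ring
  have := probReal_compl_eq_one_sub (μ := Measure.pi fun _ : Fin M => P)
    (s := G) G.toFinite.measurableSet
  linarith

end Concentration

/-! ### From uniform deviations to excess risk. -/

section ExcessRisk

variable {n M : ℕ}

lemma CBounded.abs_log_bern_le {c : ℝ} (hc : 0 < c) {p : Option (Fin n)} {t : Table}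
    (h : CBounded c p t) (x : Cube n) (b : Bool) :
    |Real.log (bern (t (p.map x)) b)| ≤ Real.log (1 / c) := by
  have hb := h x b
  have hpos := h.bern_pos hc x b
  rw [one_div, Real.log_inv, abs_of_nonpos (Real.log_nonpos hpos.le (by linarith))]
  exact neg_le_neg (Real.log_le_log hc hb.1)

/-- Linearity in the joint probabilities; the 6 counts the pairs in `Option Bool × Bool`. Pairs with
an unattained parent value contribute nothing, although their logarithms are not bounded. -/
lemma abs_crossEntropy_sub_le {c : ℝ} (hc : 0 < c) (P R : Measure (Cube n)) [IsFiniteMeasure P]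
    [IsFiniteMeasure R] {v : Fin n} {p : Option (Fin n)} {t : Table} (ht : CBounded c p t)
    {η : ℝ} (h : ∀ a b, |jointProb R v p a b - jointProb P v p a b| ≤ η) :
    |crossEntropy R v p t - crossEntropy P v p t| ≤ 6 * (η * Real.log (1 / c)) := by
  have hη : 0 ≤ η := (abs_nonneg _).trans (h none true)
  have hL : 0 ≤ Real.log (1 / c) := (abs_nonneg _).trans (ht.abs_log_bern_le hc (fun _ => true) true)
  have hterm : ∀ a b, |jointProb R v p a b * -Real.log (bern (t a) b) -
      jointProb P v p a b * -Real.log (bern (t a) b)| ≤ η * Real.log (1 / c) := by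
    intro a b
    by_cases ha : ∃ x : Cube n, p.map x = a
    · obtain ⟨x, rfl⟩ := ha
      rw [← sub_mul, abs_mul, abs_neg]
      exact mul_le_mul (h _ b) (ht.abs_log_bern_le hc x b) (abs_nonneg _) hη
    · push Not at ha
      rw [jointProb_eq_zero_of_forall_ne ha, jointProb_eq_zero_of_forall_ne ha]
      simpa using mul_nonneg hη hL
  rw [crossEntropy_eq_sum_jointProb, crossEntropy_eq_sum_jointProb, ← Finset.sum_sub_distrib]
  simp_rw [← Finset.sum_sub_distrib]
  refine (Finset.abs_sum_le_sum_abs _ _).trans ((Finset.sum_le_sum fun a _ =>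
    (Finset.abs_sum_le_sum_abs _ _).trans (Finset.sum_le_sum fun b _ => hterm a b)).trans
      (le_of_eq ?_))
  simp
  ring

/-- Every distribution of the class is a Bayesian network on a spanning tree. -/
lemma exists_isSpanningTree_of_mem {c α : ℝ} (hn : 1 ≤ n) {Q : Measure (Cube n)}
    (hQ : Q ∈ meanDiffBoundedTreeBNs n c α) :
    ∃ (pa : ParentMap n) (q : Fin n → Table), IsSpanningTree pa ∧
      (∀ v, q v ∈ feasible c α (pa v)) ∧ ∀ x, Q.real {x} = bnProb pa q x := by
  obtain ⟨-, pa, q, hpa, hq, hx⟩ := hQ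
  obtain ⟨r, hr⟩ := hpa.exists_root hn
  refine ⟨attachRoots pa r, attachTables pa r q, isSpanningTree_attachRoots hpa hr,
    fun v => ⟨fun x b => ?_, fun x y => ?_⟩, fun x => ?_⟩
  · rw [attachTables_apply]
    exact (hq v).1 x b
  · rw [attachTables_apply, attachTables_apply]
    exact (hq v).2 x y
  · simp_rw [hx, bnProb, attachTables_apply]

/-- The node entropies are the same for both trees and cancel. -/
lemma IsChowLiuOutput.sum_crossEntropy_le {c α : ℝ} (hc : 0 < c) (hc' : c ≤ 1 / 2) (hα : 0 ≤ α)
    {s : Fin M → Cube n} [IsFiniteMeasure (empirical s)] {pa : ParentMap n} {q : Fin n → Table}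
    (h : IsChowLiuOutput c α s pa q) {pa' : ParentMap n} {q' : Fin n → Table}
    (hpa' : IsSpanningTree pa') (hq' : ∀ v, q' v ∈ feasible c α (pa' v)) :
    ∑ v, crossEntropy (empirical s) v (pa v) (q v) ≤
      ∑ v, crossEntropy (empirical s) v (pa' v) (q' v) := by
  have h₁ : treeLoss c α (empirical s) pa = ∑ v, edgeCost (empirical s) v (pa v) (q v) :=
    Finset.sum_congr rfl fun v _ => edgeLoss_eq_of_isMinOn (h.2.2 v).1 (h.2.2 v).2
  have h₂ : treeLoss c α (empirical s) pa' ≤ ∑ v, edgeCost (empirical s) v (pa' v) (q' v) :=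
    Finset.sum_le_sum fun v _ => edgeLoss_le hc hc' hα _ v (hq' v)
  have h₃ := (h₁ ▸ h.2.1 pa' hpa').trans h₂
  simp_rw [edgeCost_eq fun x b => (h.2.2 _).1.1.bern_pos hc x b,
    edgeCost_eq fun x b => (hq' _).1.bern_pos hc x b, Finset.sum_add_distrib] at h₃
  linarith

lemma exists_isChowLiuOutput {c α : ℝ} (hn : 1 ≤ n) (hc : 0 < c) (hc' : c ≤ 1 / 2) (hα : 0 ≤ α)
    (s : Fin M → Cube n) [IsFiniteMeasure (empirical s)] :
    ∃ pa q, IsChowLiuOutput c α s pa q := by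
  obtain ⟨pa, hpa, hmin⟩ := Set.exists_min_image {pa : ParentMap n | IsSpanningTree pa}
    (treeLoss c α (empirical s)) (Set.toFinite _) (exists_isSpanningTree hn)
  choose q hq using fun v => exists_isMinOn_edgeCost hc hc' hα (empirical s) v (pa v)
  exact ⟨pa, q, hpa, hmin, hq⟩

lemma IsChowLiuOutput.isApproxIn {c α ε η : ℝ} (hn : 1 ≤ n) (hc : 0 < c) (hc' : c ≤ 1 / 2)
    (hα : 0 ≤ α) (P : Measure (Cube n)) [IsProbabilityMeasure P]
    {s : Fin M → Cube n} [IsFiniteMeasure (empirical s)]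
    (hs : ∀ v p a b, |jointProb (empirical s) v p a b - jointProb P v p a b| ≤ η)
    (hη : 12 * n * (η * Real.log (1 / c)) ≤ ε) {pa : ParentMap n} {q : Fin n → Table}
    (h : IsChowLiuOutput c α s pa q) :
    IsApproxIn (meanDiffBoundedTreeBNs n c α) ε P (bnMeasure pa q) := by
  have hmem := bnMeasure_mem hc h.1.1 fun v => (h.2.2 v).1
  refine ⟨hmem, fun Q hQ => ?_⟩
  have hQprob := hQ.1
  have hRprob := hmem.1
  obtain ⟨pa', q', hpa', hq', hQx⟩ := exists_isSpanningTree_of_mem hn hQ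
  have hpos := bnProb_pos hc fun v => (h.2.2 v).1.1
  have hpos' := bnProb_pos hc fun v => (hq' v).1
  have hRx : ∀ x, (bnMeasure pa q).real {x} = bnProb pa q x := fun x => by
    rw [measureReal_def, bnMeasure_singleton, ENNReal.toReal_ofReal (hpos x).le]
  -- Half of `ε` is spent on the output and half on the competitor.
  have hdev : ∀ (pa : ParentMap n) (q : Fin n → Table), (∀ v, CBounded c (pa v) (q v)) →
      |∑ v, crossEntropy (empirical s) v (pa v) (q v) - ∑ v, crossEntropy P v (pa v) (q v)| ≤
        ε / 2 := by
    intro pa q hq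
    rw [← Finset.sum_sub_distrib]
    refine (Finset.abs_sum_le_sum_abs _ _).trans ((Finset.sum_le_sum fun v _ =>
      abs_crossEntropy_sub_le hc P (empirical s) (hq v) (hs v (pa v))).trans ?_)
    simp only [Finset.sum_const, Finset.card_univ, Fintype.card_fin, nsmul_eq_mul]
    linarith
  have h₁ := abs_le.1 (hdev pa q fun v => (h.2.2 v).1.1)
  have h₂ := abs_le.1 (hdev pa' q' fun v => (hq' v).1)
  have h₃ := h.sum_crossEntropy_le hc hc' hα hpa' hq'
  rw [klDiv_eq_of_pos P _ fun x => by rw [hRx]; exact hpos x,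
    klDiv_eq_of_pos P Q fun x => by rw [hQx]; exact hpos' x]
  simp_rw [hRx, hQx]
  rw [← sum_crossEntropy fun v x b => (h.2.2 v).1.1.bern_pos hc x b,
    ← sum_crossEntropy fun v x b => (hq' v).1.bern_pos hc x b]
  exact (ENNReal.ofReal_le_ofReal (by linarith)).trans ENNReal.ofReal_add_le

end ExcessRisk

/-- The power 5 absorbs the number of events: `12 n (n + 1) ≤ 24 n² ≤ (2 n)^5`, while `δ^5 ≤ δ`. -/
lemma union_bound_le {n M : ℕ} {δ η : ℝ} (hn : 1 ≤ n) (hδ : 0 < δ) (hδ' : δ < 1)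
    (h : 5 * Real.log (2 * n / δ) ≤ 2 * M * η ^ 2) :
    12 * (n * (n + 1)) * Real.exp (-(2 * M * η ^ 2)) ≤ δ := by
  have hn' : (1 : ℝ) ≤ n := by exact_mod_cast hn
  have hx : 0 < 2 * n / δ := by positivity
  have hexp : Real.exp (-(2 * M * η ^ 2)) ≤ ((2 * n / δ) ^ 5)⁻¹ := by
    rw [Real.exp_neg]
    refine inv_anti₀ (by positivity) ?_
    calc (2 * n / δ) ^ 5 = Real.exp (5 * Real.log (2 * n / δ)) := by
          rw [← Real.exp_log hx, ← Real.exp_nat_mul, Real.log_exp]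
          norm_num
      _ ≤ _ := Real.exp_le_exp.2 h
  refine (mul_le_mul_of_nonneg_left hexp (by positivity)).trans ?_
  rw [div_pow, inv_div, mul_div_assoc', div_le_iff₀ (by positivity)]
  have h₁ : δ ^ 5 ≤ δ := pow_le_of_le_one hδ.le hδ'.le (by norm_num)
  have h₂ : 12 * ((n : ℝ) * (n + 1)) ≤ (2 * n) ^ 5 := by
    have : (n : ℝ) ^ 2 ≤ n ^ 5 := pow_le_pow_right₀ hn' (by norm_num)
    nlinarith
  calc _ ≤ (2 * (n : ℝ)) ^ 5 * δ := mul_le_mul h₂ h₁ (by positivity) (by positivity)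
    _ = _ := mul_comm _ _

end TreeBN

theorem mainTheorem10 :
    ∃ K : ℝ, 0 < K ∧
      ∀ (n : ℕ) (c α ε δ : ℝ), 1 ≤ n → 0 < c → c ≤ 1 / 2 → 0 ≤ α → 0 < ε → 0 < δ → δ < 1 →
      ∀ (P : Measure (TreeBN.Cube n)) [IsProbabilityMeasure P] (M : ℕ),
        K * ((n : ℝ) ^ 2 / ε ^ 2 * Real.log (1 / c) ^ 2 * Real.log (2 * n / δ)) ≤ M →
        (∀ s : Fin M → TreeBN.Cube n, ∃ pa q, TreeBN.IsChowLiuOutput c α s pa q) ∧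
        1 - δ ≤ (Measure.pi (fun _ : Fin M => P)).real
          {s | ∀ pa q, TreeBN.IsChowLiuOutput c α s pa q →
            TreeBN.IsApproxIn (TreeBN.meanDiffBoundedTreeBNs n c α) ε P (TreeBN.bnMeasure pa q) ∧
            (1 / 2 - c ≤ α →
              TreeBN.IsApproxIn (TreeBN.diffBoundedTreeBNs n c α) ε P
                (TreeBN.bnMeasure pa q))} := by
  -- With `η = ε / (12 n log (1 / c))`, the bound `2 M η² ≥ 5 log (2 n / δ)` needs `K = 5 * 144 /
  -- 2`.
  refine ⟨360, by norm_num, ?_⟩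
  intro n c α ε δ hn hc hc' hα hε hδ hδ' P _ M hM
  have hn' : (1 : ℝ) ≤ n := by exact_mod_cast hn
  have hL : 0 < Real.log (1 / c) := Real.log_pos (by rw [lt_div_iff₀ hc]; linarith)
  have hl : 0 < Real.log (2 * n / δ) := Real.log_pos (by rw [lt_div_iff₀ hδ]; linarith)
  have hMpos : 0 < M := by
    have : (0 : ℝ) < M := lt_of_lt_of_le (by positivity) hM
    exact_mod_cast this
  have hfin := fun s => TreeBN.isFiniteMeasure_empirical (n := n) hMpos s
  refine ⟨fun s => TreeBN.exists_isChowLiuOutput hn hc hc' hα s, ?_⟩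
  set η := ε / (12 * n * Real.log (1 / c)) with hη
  have hηL : 12 * n * (η * Real.log (1 / c)) ≤ ε := by
    rw [hη]
    apply le_of_eq
    field_simp
  have hexp : 5 * Real.log (2 * n / δ) ≤ 2 * M * η ^ 2 := by
    have h := mul_le_mul_of_nonneg_right hM (by positivity : 0 ≤ 2 * η ^ 2)
    calc 5 * Real.log (2 * n / δ) = _ := by
          rw [hη]
          field_simp
          norm_num
      _ ≤ _ := h
      _ = _ := by ring
  refine le_trans ?_ ((TreeBN.pi_real_jointProb_deviation_ge P hMpos
    (by positivity : 0 ≤ η)).trans (measureReal_mono fun s hs pa q h => ?_))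
  · linarith [TreeBN.union_bound_le hn hδ hδ' hexp]
  · have happrox := h.isApproxIn hn hc hc' hα P hs hηL
    exact ⟨happrox, fun hα' => by rwa [TreeBN.diffBoundedTreeBNs_eq hc hc' hα']⟩
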